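/- Let $M$ be a smooth manifold of dimension $m+2$ ($m\ge 0$) with a smooth Lorentzian metric $g$ of signature $(-,+,\dots,+)$ and Levi-Civita connection $\nabla$. Let $T=T_{ij}^k\,dx^i\otimes dx^j\otimes\partial_k$ be a homogeneous structure on $(M,g)$: a smooth $(2,1)$ tensor field such that the connection $\tilde\nabla:=\nabla-T$ (that is, $\tilde\nabla_XY=\nabla_XY-T(X,Y)$), called the canonical connection associated with $T$, satisfies $\tilde\nabla g=0$, $\tilde\nabla T=0$ and $\tilde\nabla\tilde R=0$, where $\tilde R$ is the curvature of $\tilde\nabla$. Let $\gamma:I\to M$ be an affinely parametrized null geodesic of $g$ on an open interval $I$, with $\gamma'\neq 0$. A chart $\mu=(u,v,y^1,\dots,y^m)$ of $M$ is *adapted* to $\gamma|_J$, for an open interval $J\subseteq I$, if its domain contains $\gamma(J)$, $\mu(\gamma(t))=(t,0,0)$ for $t\in J$, and in the whole chart $$g=du\,dv+\alpha\,dv^2+\sum_i\beta_i\,dy^i\,dv+\sum_{i,j}C_{ij}\,dy^i\,dy^j$$ with functions $\alpha,\beta_i,C_{ij}$ of $(u,v,y)$ and $(C_{ij})$ positive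 definite. Let $\mathcal U$ be any family of pairs $(\mu,J)$, each consisting of an open interval $J\subseteq I$ and a chart $\mu$ adapted to $\gamma|_J$, whose intervals $J$ cover $I$. For $\Omega>0$ put $\psi_\Omega(u,v,y)=(u,\Omega^2v,\Omega y)$. Say that $T$ has a well-defined Penrose limit along $\gamma$ if, for every $(\mu,J)\in\mathcal U$, in the coordinates $\mu$ the pulled-back tensors $\psi_\Omega^*T$ converge as $\Omega\to0^+$ at every point of $\gamma(J)$. Then the following are equivalent: 1. $T$ has a well-defined Penrose limit along $\gamma$; 2. for every $(\mu,J)\in\mathcal U$, the tensors $\psi_\Omega^*T$ converge as $\Omega\to0^+$ at every point $(u,v,y)$ of the chart $\mu$ with $u\in J$; 3. $\gamma$ can be reparametrized to a geodesic of the canonical connection: there are an open interval $J'$ and a diffeomorphism $s:J'\to I$ such that $\gamma\circ s$ is a geodesic of $\tilde\nabla$; 4. for every $(\mu,J)\in\mathcal U$, the components $T^{y^i}_{uu}$ ($1\le i\le m$) and $T^v_{uu}$ in the coordinates $\mu$ vanish along $\gamma(J)$. -/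

import Mathlib

open Set Filter Topology Bundle
open scoped Manifold ContDiff

namespace PenroseLimit

noncomputable section

/-- The coordinate space of a manifold of dimension `m + 2`. In adapted coordinates the index `0`
is the index of `u`, the index `1` is the index of `v`, and `i.succ.succ` is the index of the
transverse coordinate `y^i`, `i : Fin m`. -/
abbrev Coord (m : ℕ) : Type := EuclideanSpace ℝ (Fin (m + 2))

/-- The `i`-th coordinate vector. -/
def coordVec {m : ℕ} (i : Fin (m + 2)) : Coord m := EuclideanSpace.single i 1

/-- The `i`-th partial derivative of a function on coordinate space. -/
def pderiv {m : ℕ} (i : Fin (m + 2)) (f : Coord m → ℝ) (x : Coord m) : ℝ :=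
  fderiv ℝ f x (coordVec i)

/-- A smooth Lorentzian metric, of signature `(-, +, …, +)`, on a smooth manifold. -/
structure LorentzianMetric (m : ℕ) (M : Type*) [TopologicalSpace M] [ChartedSpace (Coord m) M]
    [IsManifold 𝓘(ℝ, Coord m) ∞ M] where
  val : ∀ p : M, TangentSpace 𝓘(ℝ, Coord m) p →L[ℝ] TangentSpace 𝓘(ℝ, Coord m) p →L[ℝ] ℝ
  symm : ∀ p X Y, val p X Y = val p Y X
  signature : ∀ p : M, ∃ b : Module.Basis (Fin (m + 2)) ℝ (TangentSpace 𝓘(ℝ, Coord m) p),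
    ∀ i j, val p (b i) (b j) = if i = j then (if i = 0 then -1 else 1) else 0
  smooth : ContMDiff 𝓘(ℝ, Coord m)
    (𝓘(ℝ, Coord m).prod 𝓘(ℝ, Coord m →L[ℝ] Coord m →L[ℝ] ℝ)) ∞
    (fun p ↦ TotalSpace.mk' (Coord m →L[ℝ] Coord m →L[ℝ] ℝ) p (val p))

section Manifold

variable {m : ℕ} {M : Type*} [TopologicalSpace M] [ChartedSpace (Coord m) M]

/-- The coordinate vector field `∂_i` of the chart `φ`, at the point with coordinates `x`. -/
def coordField (φ : OpenPartialHomeomorph M (Coord m)) (x : Coord m) (i : Fin (m + 2)) :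
    TangentSpace 𝓘(ℝ, Coord m) (φ.symm x) :=
  mfderiv 𝓘(ℝ, Coord m) 𝓘(ℝ, Coord m) φ.symm x (coordVec i)

/-- The coordinates of a tangent vector in the chart `φ`. -/
def vecComp (φ : OpenPartialHomeomorph M (Coord m)) (p : M)
    (X : TangentSpace 𝓘(ℝ, Coord m) p) : Coord m :=
  mfderiv 𝓘(ℝ, Coord m) 𝓘(ℝ, Coord m) φ p X

/-- A `(2,1)` tensor field `T`, as the bilinear maps `(X, Y) ↦ T_X Y` on the tangent spaces. -/
abbrev TensorField (m : ℕ) (M : Type*) [TopologicalSpace M] [ChartedSpace (Coord m) M] :=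
  ∀ p : M, TangentSpace 𝓘(ℝ, Coord m) p →L[ℝ] TangentSpace 𝓘(ℝ, Coord m) p →L[ℝ]
    TangentSpace 𝓘(ℝ, Coord m) p

/-- The components `T_{ij}^k` in the chart `φ`, where `T = T_{ij}^k dx^i ⊗ dx^j ⊗ ∂_k`. -/
def tensorComp (T : TensorField m M) (φ : OpenPartialHomeomorph M (Coord m))
    (x : Coord m) (i j k : Fin (m + 2)) : ℝ :=
  vecComp φ (φ.symm x) (T (φ.symm x) (coordField φ x i) (coordField φ x j)) k

/-- A curve `γ` satisfies on `I` the geodesic equation of the connection that has in the chart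
`φ` the coefficients `Γ φ x i j k`, where `∇_{∂_i} ∂_j = Γ_{ij}^k ∂_k`. -/
def IsGeodesicOn
    (Γ : OpenPartialHomeomorph M (Coord m) → Coord m →
      Fin (m + 2) → Fin (m + 2) → Fin (m + 2) → ℝ)
    (γ : ℝ → M) (I : Set ℝ) : Prop :=
  ContMDiffOn 𝓘(ℝ, ℝ) 𝓘(ℝ, Coord m) ∞ γ I ∧
  ∀ φ ∈ IsManifold.maximalAtlas 𝓘(ℝ, Coord m) ∞ M, ∀ t ∈ I, γ t ∈ φ.source →
    ∀ k, deriv (deriv fun s ↦ φ (γ s) k) t +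
      ∑ i, ∑ j, Γ φ (φ (γ t)) i j k *
        deriv (fun s ↦ φ (γ s) i) t * deriv (fun s ↦ φ (γ s) j) t = 0

/-- The velocity vector of a curve. -/
def velocity (γ : ℝ → M) (t : ℝ) : TangentSpace 𝓘(ℝ, Coord m) (γ t) :=
  mfderiv 𝓘(ℝ, ℝ) 𝓘(ℝ, Coord m) γ t (1 : ℝ)

variable [IsManifold 𝓘(ℝ, Coord m) ∞ M]

/-- The components `g_{ij}` in the chart `φ`. -/
def metricComp (g : LorentzianMetric m M) (φ : OpenPartialHomeomorph M (Coord m))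
    (x : Coord m) (i j : Fin (m + 2)) : ℝ :=
  g.val (φ.symm x) (coordField φ x i) (coordField φ x j)

/-- The Christoffel symbols `Γ_{ij}^k` of the Levi-Civita connection `∇` of `g`. -/
def leviCivita (g : LorentzianMetric m M) (φ : OpenPartialHomeomorph M (Coord m))
    (x : Coord m) (i j k : Fin (m + 2)) : ℝ :=
  (1 / 2) * ∑ l, ((Matrix.of (metricComp g φ x))⁻¹ k l) *
    (pderiv i (fun y ↦ metricComp g φ y j l) x + pderiv j (fun y ↦ metricComp g φ y i l) x
      - pderiv l (fun y ↦ metricComp g φ y i j) x)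

/-- The connection coefficients of the canonical connection `∇ - T` associated with `T`. -/
def canonical (g : LorentzianMetric m M) (T : TensorField m M)
    (φ : OpenPartialHomeomorph M (Coord m)) (x : Coord m) (i j k : Fin (m + 2)) : ℝ :=
  leviCivita g φ x i j k - tensorComp T φ x i j k

/-- The components of the curvature of the canonical connection:
`R(∂_i, ∂_j) ∂_k = R_{ijk}^l ∂_l`. -/
def curvature (g : LorentzianMetric m M) (T : TensorField m M)
    (φ : OpenPartialHomeomorph M (Coord m)) (x : Coord m) (i j k l : Fin (m + 2)) : ℝ :=
  pderiv i (fun y ↦ canonical g T φ y j k l) x - pderiv j (fun y ↦ canonical g T φ y i k l) x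
    + ∑ a, (canonical g T φ x i a l * canonical g T φ x j k a
      - canonical g T φ x j a l * canonical g T φ x i k a)

/-- The component `(i, j)` of the covariant derivative of `g` in the direction `∂_l`, for the
canonical connection. -/
def covDerivMetric (g : LorentzianMetric m M) (T : TensorField m M)
    (φ : OpenPartialHomeomorph M (Coord m)) (x : Coord m) (l i j : Fin (m + 2)) : ℝ :=
  pderiv l (fun y ↦ metricComp g φ y i j) x
    - ∑ a, canonical g T φ x l i a * metricComp g φ x a j
    - ∑ a, canonical g T φ x l j a * metricComp g φ x i a

/-- The component `(i, j; k)` of the covariant derivative of `T` in the direction `∂_l`, for the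
canonical connection. -/
def covDerivTensor (g : LorentzianMetric m M) (T : TensorField m M)
    (φ : OpenPartialHomeomorph M (Coord m)) (x : Coord m) (l i j k : Fin (m + 2)) : ℝ :=
  pderiv l (fun y ↦ tensorComp T φ y i j k) x
    + ∑ a, canonical g T φ x l a k * tensorComp T φ x i j a
    - ∑ a, canonical g T φ x l i a * tensorComp T φ x a j k
    - ∑ a, canonical g T φ x l j a * tensorComp T φ x i a k

/-- The component `(i, j, k; l)` of the covariant derivative of the curvature of the canonical
connection in the direction `∂_q`, for the canonical connection. -/
def covDerivCurvature (g : LorentzianMetric m M) (T : TensorField m M)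
    (φ : OpenPartialHomeomorph M (Coord m)) (x : Coord m) (q i j k l : Fin (m + 2)) : ℝ :=
  pderiv q (fun y ↦ curvature g T φ y i j k l) x
    + ∑ a, canonical g T φ x q a l * curvature g T φ x i j k a
    - ∑ a, canonical g T φ x q i a * curvature g T φ x a j k l
    - ∑ a, canonical g T φ x q j a * curvature g T φ x i a k l
    - ∑ a, canonical g T φ x q k a * curvature g T φ x i j a l

/-- `T` is a homogeneous structure on `(M, g)`: a smooth `(2,1)` tensor field such that the
connection `∇ - T` is metric and such that `T` and the curvature of `∇ - T` are parallel for
`∇ - T`. -/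
structure IsHomogeneousStructure (g : LorentzianMetric m M) (T : TensorField m M) : Prop where
  smooth : ContMDiff 𝓘(ℝ, Coord m)
    (𝓘(ℝ, Coord m).prod 𝓘(ℝ, Coord m →L[ℝ] Coord m →L[ℝ] Coord m)) ∞
    (fun p ↦ TotalSpace.mk' (Coord m →L[ℝ] Coord m →L[ℝ] Coord m) p (T p))
  metric : ∀ φ ∈ IsManifold.maximalAtlas 𝓘(ℝ, Coord m) ∞ M, ∀ x ∈ φ.target, ∀ l i j,
    covDerivMetric g T φ x l i j = 0
  parallel : ∀ φ ∈ IsManifold.maximalAtlas 𝓘(ℝ, Coord m) ∞ M, ∀ x ∈ φ.target, ∀ l i j k,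
    covDerivTensor g T φ x l i j k = 0
  parallel_curvature : ∀ φ ∈ IsManifold.maximalAtlas 𝓘(ℝ, Coord m) ∞ M, ∀ x ∈ φ.target,
    ∀ q i j k l, covDerivCurvature g T φ x q i j k l = 0

/-- `γ` is a null geodesic of `g`, affinely parametrized by the open interval `I`. -/
structure IsNullGeodesic (g : LorentzianMetric m M) (γ : ℝ → M) (I : Set ℝ) : Prop where
  isOpen : IsOpen I
  interval : I.OrdConnected
  geodesic : IsGeodesicOn (leviCivita g) γ I
  velocity_ne_zero : ∀ t ∈ I, velocity γ t ≠ (0 : TangentSpace 𝓘(ℝ, Coord m) (γ t))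
  null : ∀ t ∈ I, g.val (γ t) (velocity γ t) (velocity γ t) = 0

/-- `γ : I → M` can be reparametrized, by a diffeomorphism `s` from an open interval `J` onto
`I`, to a geodesic `γ ∘ s` of the canonical connection associated with `T`. -/
def ReparametrizesToCanonicalGeodesic (g : LorentzianMetric m M) (T : TensorField m M)
    (γ : ℝ → M) (I : Set ℝ) : Prop :=
  ∃ (J : Set ℝ) (s : ℝ → ℝ), IsOpen J ∧ J.OrdConnected ∧ ContDiffOn ℝ ∞ s J ∧ BijOn s J I ∧
    (∀ t ∈ J, deriv s t ≠ 0) ∧ IsGeodesicOn (canonical g T) (γ ∘ s) J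

/-- `φ = (u, v, y^1, …, y^m)` is a chart adapted to the piece `γ|_J` of the null geodesic `γ`:
along it `γ(t) = (t, 0, 0)`, and the metric has in the chart the form
`g = du dv + α dv² + β_i dy^i dv + C_{ij} dy^i dy^j` with `(C_{ij})` positive definite.
The symmetric product `du dv` contributes `1 / 2` to `g_{uv}`. -/
structure IsAdaptedChart (g : LorentzianMetric m M) (γ : ℝ → M) (J : Set ℝ)
    (φ : OpenPartialHomeomorph M (Coord m)) : Prop where
  mem_atlas : φ ∈ IsManifold.maximalAtlas 𝓘(ℝ, Coord m) ∞ M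
  isOpen : IsOpen J
  interval : J.OrdConnected
  mem_source : ∀ t ∈ J, γ t ∈ φ.source
  curve : ∀ t ∈ J, φ (γ t) = t • coordVec 0
  metric_uu : ∀ x ∈ φ.target, metricComp g φ x 0 0 = 0
  metric_uv : ∀ x ∈ φ.target, metricComp g φ x 0 1 = 1 / 2
  metric_uy : ∀ x ∈ φ.target, ∀ i : Fin m, metricComp g φ x 0 i.succ.succ = 0
  metric_yy : ∀ x ∈ φ.target,
    (Matrix.of fun i j : Fin m ↦ metricComp g φ x i.succ.succ j.succ.succ).PosDef

/-- A choice of adapted charts along the null geodesic `γ : I → M`: a set of pairs `(φ, J)` of a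
chart and an open subinterval of `I`, with `φ` adapted to `γ|_J`, whose intervals cover `I`. -/
structure IsAdaptedCover (g : LorentzianMetric m M) (γ : ℝ → M) (I : Set ℝ)
    (𝒰 : Set (OpenPartialHomeomorph M (Coord m) × Set ℝ)) : Prop where
  adapted : ∀ U ∈ 𝒰, IsAdaptedChart g γ U.2 U.1
  subset : ∀ U ∈ 𝒰, U.2 ⊆ I
  cover : ∀ t ∈ I, ∃ U ∈ 𝒰, t ∈ U.2

end Manifold

/-- The map `ψ_Ω : (u, v, y) ↦ (u, Ω² v, Ω y)`. -/
def scaling {m : ℕ} (Ω : ℝ) (x : Coord m) : Coord m :=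
  WithLp.toLp 2 (Fin.cons (x 0) (Fin.cons (Ω ^ 2 * x 1) fun i : Fin m ↦ Ω * x i.succ.succ))

/-- The components of the pull-back `ψ^* S` of a `(2,1)` tensor field `S` on coordinate space by
a local diffeomorphism `ψ`: with `D = dψ_x`, it is `(X, Y) ↦ D⁻¹ S_{ψ(x)}(D X, D Y)`. -/
def pullback {m : ℕ} (ψ : Coord m → Coord m)
    (S : Coord m → Fin (m + 2) → Fin (m + 2) → Fin (m + 2) → ℝ)
    (x : Coord m) (i j k : Fin (m + 2)) : ℝ :=
  let D : Matrix (Fin (m + 2)) (Fin (m + 2)) ℝ :=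
    Matrix.of fun a b ↦ pderiv b (fun y ↦ ψ y a) x
  ∑ a, ∑ b, ∑ c, D a i * D b j * D⁻¹ k c * S (ψ x) a b c

section Limit

variable {m : ℕ} {M : Type*} [TopologicalSpace M] [ChartedSpace (Coord m) M]

/-- At the point with coordinates `x` in the chart `φ`, the pull-backs of `T` by
`φ⁻¹ ∘ ψ_Ω ∘ φ` converge to a tensor as `Ω → 0⁺`. -/
def HasLimitAt (T : TensorField m M) (φ : OpenPartialHomeomorph M (Coord m)) (x : Coord m) :
    Prop :=
  ∃ TPl : Fin (m + 2) → Fin (m + 2) → Fin (m + 2) → ℝ,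
    Tendsto (fun Ω : ℝ ↦ pullback (scaling Ω) (tensorComp T φ) x) (𝓝[>] 0) (𝓝 TPl)

/-- `T` has a well-defined Penrose limit along `γ`: at all points of `γ`, in all the adapted
charts of the cover, the rescaled tensors converge. -/
def HasPenroseLimitAlong (T : TensorField m M) (γ : ℝ → M)
    (𝒰 : Set (OpenPartialHomeomorph M (Coord m) × Set ℝ)) : Prop :=
  ∀ U ∈ 𝒰, ∀ t ∈ U.2, HasLimitAt T U.1 (U.1 (γ t))

/-- `T` has a well-defined Penrose limit on a neighborhood of `γ`: the rescaled tensors converge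
at all points `(u, v, y)` of the adapted charts that lie over the points `(u, 0, 0)` of `γ`
(there `(u, Ω² v, Ω y)` lies in the chart for all small `Ω`). -/
def HasPenroseLimitNear (T : TensorField m M)
    (𝒰 : Set (OpenPartialHomeomorph M (Coord m) × Set ℝ)) : Prop :=
  ∀ U ∈ 𝒰, ∀ x ∈ U.1.target, x 0 ∈ U.2 → HasLimitAt T U.1 x

/-- The components `T^{y^i}_{uu}` and `T^v_{uu}` vanish along `γ` in the adapted charts. -/
def ComponentsVanish (T : TensorField m M) (γ : ℝ → M)
    (𝒰 : Set (OpenPartialHomeomorph M (Coord m) × Set ℝ)) : Prop :=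
  ∀ U ∈ 𝒰, ∀ t ∈ U.2, (∀ i : Fin m, tensorComp T U.1 (U.1 (γ t)) 0 0 i.succ.succ = 0) ∧
    tensorComp T U.1 (U.1 (γ t)) 0 0 1 = 0

end Limit

end

end PenroseLimit

open PenroseLimit

namespace PenroseLimit

/-! ### Reparametrization of an interval -/

/-! Give `u`, `v`, `y^i` the weights 0, 2, 1. Since `dψ_Ω` is diagonal, the component `T_{ij}^k` of
the pull-back is `Ω^(w_i + w_j - w_k)` times that component at `ψ_Ω(x)`, a point tending to `(u, 0,
0)` on `γ` (`pullback_scaling`). Only `T_{uu}^v` (exponent -2) and `T_{uy}^v`, `T_{yu}^v`,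
`T_{uu}^y` (exponent -1) can diverge. Both `∇` and `∇ - T` are metric, so each `T_X` is skew for
`g`. As `∂_u` is null and pairs only with `∂_v`, this forces `T_{Xu}^v = 0` on the whole chart
(`tensorComp_u_v`) and makes `T_{uy}^v` vanish wherever `T_{uu}^y` does (`tensorComp_y_v`). If
`T_{uu}^y = 0` along `γ`, the remaining singular entries are difference quotients in `Ω` and
converge, even off `γ`. Conversely, `ψ_Ω` fixes the points of `γ`, where `Ω⁻¹ T_{uu}^y` converges
only if `T_{uu}^y = 0`. On the geodesic side, the canonical geodesic equation for `γ ∘ s` reduces to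
`s'' γ' = s'^2 T(γ', γ')` (`canonical_geodesic_comp`). In an adapted chart `γ' = ∂_u`, so it forces
`T_{uu}^y = 0`. Conversely this vanishing gives `T(γ', γ') = f γ'`, and `s'' = f(s) s'^2` has a
solution onto `I` (`exists_reparametrization`). -/

theorem exists_primitive_on {I : Set ℝ} (hI : IsOpen I) (hI' : I.OrdConnected) {f : ℝ → ℝ}
    (hf : ContDiffOn ℝ ∞ f I) :
    ∃ F : ℝ → ℝ, ContDiffOn ℝ ∞ F I ∧ ∀ t ∈ I, HasDerivAt F (f t) t := by
  rcases I.eq_empty_or_nonempty with rfl | ⟨a, ha⟩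
  · exact ⟨0, contDiffOn_empty, by simp⟩
  have key : ∀ t ∈ I, HasDerivAt (fun u ↦ ∫ x in a..u, f x) (f t) t := by
    intro t ht
    refine intervalIntegral.integral_hasDerivAt_right ?_ ?_
      (hf.continuousOn.continuousAt (hI.mem_nhds ht))
    · exact (hf.continuousOn.mono (hI'.uIcc_subset ha ht)).intervalIntegrable
    · exact hf.continuousOn.stronglyMeasurableAtFilter hI t ht
  refine ⟨_, ?_, key⟩
  rw [contDiffOn_infty_iff_deriv_of_isOpen hI]
  refine ⟨fun t ht ↦ (key t ht).differentiableAt.differentiableWithinAt, ?_⟩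
  exact hf.congr fun t ht ↦ (key t ht).deriv

/-- A smooth function with positive derivative on an open interval is a diffeomorphism onto an
open interval. -/
theorem exists_openPartialHomeomorph_of_deriv_pos {I : Set ℝ} (hI : IsOpen I)
    (hI' : I.OrdConnected) {h h' : ℝ → ℝ} (hh : ContDiffOn ℝ ∞ h I)
    (hd : ∀ t ∈ I, HasDerivAt h (h' t) t) (hpos : ∀ t ∈ I, 0 < h' t) :
    ∃ e : OpenPartialHomeomorph ℝ ℝ, (e : ℝ → ℝ) = h ∧ e.source = I ∧ e.target = h '' I := by
  have hmono : StrictMonoOn h I := by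
    refine strictMonoOn_of_deriv_pos hI'.convex hh.continuousOn fun t ht ↦ ?_
    rw [hI.interior_eq] at ht
    rw [(hd t ht).deriv]
    exact hpos t ht
  refine ⟨OpenPartialHomeomorph.ofContinuousOpenRestrict (hmono.injOn.toPartialEquiv h I)
    hh.continuousOn ?_ hI, rfl, rfl, rfl⟩
  rw [isOpenMap_iff_nhds_le]
  rintro ⟨x, hx⟩
  -- A nonzero strict derivative makes `h` open at `x`; since `I` is open, neighbourhoods in the
  -- subtype are those of the line.
  have hs : HasStrictDerivAt h (h' x) x :=
    (hh.contDiffAt (hI.mem_nhds hx)).hasStrictDerivAt' (hd x hx) (by simp)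
  have h1 : map (I.domRestrict h) (𝓝 ⟨x, hx⟩) = map h (map Subtype.val (𝓝 (⟨x, hx⟩ : I))) := by
    rw [map_map]; rfl
  change 𝓝 (h x) ≤ map (I.domRestrict h) (𝓝 ⟨x, hx⟩)
  rw [h1, ← hs.map_nhds_eq (hpos x hx).ne']
  exact (congrArg (map h) (map_nhds_subtype_coe_eq_nhds hx (hI.mem_nhds hx))).ge

/-- The equation `s'' = f(s) s'^2` has a solution that is a diffeomorphism onto a given open
interval. -/
theorem exists_reparametrization {I : Set ℝ} (hI : IsOpen I) (hI' : I.OrdConnected) {f : ℝ → ℝ}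
    (hf : ContDiffOn ℝ ∞ f I) :
    ∃ (J : Set ℝ) (s : ℝ → ℝ), IsOpen J ∧ J.OrdConnected ∧ ContDiffOn ℝ ∞ s J ∧ BijOn s J I ∧
      (∀ t ∈ J, deriv s t ≠ 0) ∧
      ∀ t ∈ J, deriv (deriv s) t = f (s t) * deriv s t ^ 2 := by
  obtain ⟨F, hF, hFd⟩ := exists_primitive_on hI hI' hf
  -- The equation integrates to `s' = exp (F ∘ s)` with `F' = f`, so the inverse `h` of `s` must
  -- satisfy `h' = exp (-F)`. Defining `s` as the inverse of `h` makes it onto `I`.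
  have hE : ContDiffOn ℝ ∞ (fun t ↦ Real.exp (-F t)) I := hF.neg.exp
  obtain ⟨h, hh, hhd⟩ := exists_primitive_on hI hI' hE
  obtain ⟨e, rfl, hes, het⟩ := exists_openPartialHomeomorph_of_deriv_pos hI hI' hh hhd
    fun t _ ↦ Real.exp_pos _
  have hmem : ∀ t ∈ e.target, e.symm t ∈ I := fun t ht ↦ hes ▸ e.map_target ht
  have hsd : ∀ t ∈ e.target, HasDerivAt e.symm (Real.exp (F (e.symm t))) t := by
    intro t ht
    have := e.hasDerivAt_symm ht (Real.exp_pos _).ne' (hhd _ (hmem t ht))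
    rwa [← Real.exp_neg, neg_neg] at this
  refine ⟨e.target, e.symm, e.open_target, ?_, ?_, ?_, ?_, ?_⟩
  · rw [het]
    exact (hI'.isPreconnected.image _ hh.continuousOn).ordConnected
  · intro t ht
    exact (e.contDiffAt_symm_deriv (Real.exp_pos _).ne' ht (hhd _ (hmem t ht))
      (hh.contDiffAt (hI.mem_nhds (hmem t ht)))).contDiffWithinAt
  · rw [← hes]
    exact e.symm.bijOn
  · intro t ht
    rw [(hsd t ht).deriv]
    exact (Real.exp_pos _).ne'
  · intro t ht
    have hev : deriv e.symm =ᶠ[𝓝 t] fun t ↦ Real.exp (F (e.symm t)) :=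
      eventually_of_mem (e.open_target.mem_nhds ht) fun τ hτ ↦ (hsd τ hτ).deriv
    have hd : HasDerivAt (fun t ↦ Real.exp (F (e.symm t))) _ t :=
      ((hFd _ (hmem t ht)).comp t (hsd t ht)).exp
    rw [hev.deriv_eq, (hsd t ht).deriv, hd.deriv]
    simp only [Function.comp]
    ring

theorem deriv_deriv_comp {c s : ℝ → ℝ} {t : ℝ} (hs : ContDiffAt ℝ 2 s t)
    (hc : ContDiffAt ℝ 2 c (s t)) :
    deriv (c ∘ s) t = deriv s t * deriv c (s t) ∧
    deriv (deriv (c ∘ s)) t =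
      deriv (deriv s) t * deriv c (s t) + deriv s t ^ 2 * deriv (deriv c) (s t) := by
  have h1 : ∀ᶠ τ in 𝓝 t, DifferentiableAt ℝ s τ :=
    (hs.eventually (by simp)).mono fun τ h ↦ h.differentiableAt (by simp)
  have h2 : ∀ᶠ τ in 𝓝 t, DifferentiableAt ℝ c (s τ) :=
    (hs.continuousAt.eventually (hc.eventually (by simp))).mono
      fun τ h ↦ h.differentiableAt (by simp)
  have h3 : deriv (c ∘ s) =ᶠ[𝓝 t] fun τ ↦ deriv s τ * deriv c (s τ) := by
    filter_upwards [h1, h2] with τ hτ hτ'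
    rw [deriv_comp τ hτ' hτ, mul_comm]
  refine ⟨h3.eq_of_nhds, ?_⟩
  have hs' : DifferentiableAt ℝ (deriv s) t :=
    (hs.derivWithin (m := 1) (by norm_num)).differentiableAt (by simp)
  have hc' : DifferentiableAt ℝ (deriv c) (s t) :=
    (hc.derivWithin (m := 1) (by norm_num)).differentiableAt (by simp)
  have hd : HasDerivAt (fun τ ↦ deriv s τ * deriv c (s τ)) _ t :=
    hs'.hasDerivAt.mul (hc'.hasDerivAt.comp t h1.self_of_nhds.hasDerivAt)
  rw [h3.deriv_eq, hd.deriv]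
  ring

/-! ### The scaling -/

section Scaling

variable {m : ℕ}

/-- The exponents of the scaling: `0` for `u`, `2` for `v`, `1` for `y^i`. -/
def weight (m : ℕ) : Fin (m + 2) → ℕ := Fin.cons 0 (Fin.cons 2 fun _ ↦ 1)

@[simp] theorem weight_zero : weight m 0 = 0 := rfl
@[simp] theorem weight_one : weight m 1 = 2 := rfl
@[simp] theorem weight_succ_succ (i : Fin m) : weight m i.succ.succ = 1 := rfl

theorem scaling_apply (Ω : ℝ) (x : Coord m) (a : Fin (m + 2)) :
    scaling Ω x a = Ω ^ weight m a * x a := by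
  refine Fin.cases ?_ (fun a ↦ Fin.cases ?_ (fun i ↦ ?_) a) a
  · simp [scaling]
  · change Ω ^ 2 * x 1 = Ω ^ 2 * x 1
    rfl
  · simp [scaling]

theorem coordVec_apply (i j : Fin (m + 2)) :
    (coordVec i : Coord m) j = if j = i then 1 else 0 := by
  simp [coordVec, PiLp.single_apply]

theorem scaling_smul_coordVec_zero (Ω t : ℝ) :
    scaling Ω (t • coordVec 0 : Coord m) = t • coordVec 0 := by
  ext a
  rw [scaling_apply]
  rcases eq_or_ne a 0 with rfl | ha
  · simp
  · simp [coordVec_apply, ha]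

theorem scaling_zero (x : Coord m) : scaling 0 x = x 0 • coordVec 0 := by
  ext a
  rw [scaling_apply]
  refine Fin.cases ?_ (fun a ↦ Fin.cases ?_ (fun i ↦ ?_) a) a
  · simp [coordVec_apply]
  · change (0 : ℝ) ^ 2 * _ = _
    simp [coordVec_apply]
  · simp [coordVec_apply]

/-- Entries with exponent -1 are read as difference quotients at `Ω = 0`, hence differentiability in
`Ω` at a fixed point. -/
theorem differentiable_scaling (x : Coord m) : Differentiable ℝ fun Ω ↦ scaling Ω x := by
  rw [differentiable_euclidean]
  intro a
  simp only [scaling_apply]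
  fun_prop

theorem pderiv_scaling (Ω : ℝ) (x : Coord m) (a b : Fin (m + 2)) :
    pderiv b (fun y ↦ scaling Ω y a) x =
      Matrix.diagonal (fun a ↦ Ω ^ weight m a) a b := by
  have h : (fun y : Coord m ↦ scaling Ω y a)
      = ⇑((Ω ^ weight m a) • (EuclideanSpace.proj a : Coord m →L[ℝ] ℝ)) := by
    ext y
    simp [scaling_apply]
  rw [pderiv, h, ContinuousLinearMap.fderiv, Matrix.diagonal_apply]
  simp [coordVec_apply]

theorem pullback_scaling {Ω : ℝ} (hΩ : 0 < Ω)
    (S : Coord m → Fin (m + 2) → Fin (m + 2) → Fin (m + 2) → ℝ)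
    (x : Coord m) (i j k : Fin (m + 2)) :
    pullback (scaling Ω) S x i j k =
      Ω ^ weight m i * Ω ^ weight m j * (Ω ^ weight m k)⁻¹ * S (scaling Ω x) i j k := by
  have hD : (Matrix.of fun a b : Fin (m + 2) ↦ pderiv b (fun y ↦ scaling Ω y a) x)
      = Matrix.diagonal fun a ↦ Ω ^ weight m a := by
    ext a b
    exact pderiv_scaling Ω x a b
  have hD' : (Matrix.diagonal fun a ↦ Ω ^ weight m a)⁻¹
      = Matrix.diagonal fun a ↦ (Ω ^ weight m a)⁻¹ := by
    refine Matrix.inv_eq_left_inv ?_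
    rw [Matrix.diagonal_mul_diagonal, ← Matrix.diagonal_one]
    congr 1
    ext a
    exact inv_mul_cancel₀ (pow_pos hΩ _).ne'
  simp only [pullback, hD, hD']
  rw [Finset.sum_eq_single i, Finset.sum_eq_single j, Finset.sum_eq_single k]
  · simp
  all_goals simp +contextual [Matrix.diagonal_apply, eq_comm]

end Scaling

/-! ### Tensors and vectors in charts -/

section Charts

variable {m : ℕ} {M : Type*} [TopologicalSpace M] [ChartedSpace (Coord m) M]

theorem mdifferentiable_chart {φ : OpenPartialHomeomorph M (Coord m)}
    (hφ : φ ∈ IsManifold.maximalAtlas 𝓘(ℝ, Coord m) ∞ M) :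
    φ.MDifferentiable 𝓘(ℝ, Coord m) 𝓘(ℝ, Coord m) :=
  ⟨(contMDiffOn_of_mem_maximalAtlas hφ).mdifferentiableOn (by simp),
    (contMDiffOn_symm_of_mem_maximalAtlas hφ).mdifferentiableOn (by simp)⟩

theorem eq_sum_coordField {φ : OpenPartialHomeomorph M (Coord m)}
    (hφ : φ ∈ IsManifold.maximalAtlas 𝓘(ℝ, Coord m) ∞ M) {x : Coord m} (hx : x ∈ φ.target)
    (X : TangentSpace 𝓘(ℝ, Coord m) (φ.symm x)) :
    X = ∑ i, vecComp φ (φ.symm x) X i • coordField φ x i := by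
  have h1 := congr($((mdifferentiable_chart hφ).symm_comp_deriv (φ.map_target hx)) X)
  rw [φ.right_inv hx] at h1
  let A : Coord m →L[ℝ] TangentSpace 𝓘(ℝ, Coord m) (φ.symm x) :=
    mfderiv 𝓘(ℝ, Coord m) 𝓘(ℝ, Coord m) φ.symm x
  have h2 : vecComp φ (φ.symm x) X = ∑ i, vecComp φ (φ.symm x) X i • coordVec i := by
    ext k
    simp [coordVec, Pi.single_apply]
  have h3 : A (vecComp φ (φ.symm x) X) = X := h1
  calc X = A (∑ i, vecComp φ (φ.symm x) X i • coordVec i) := by rw [← h2, h3]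
    _ = ∑ i, vecComp φ (φ.symm x) X i • coordField φ x i := by
      simp only [map_sum, map_smul]
      rfl

theorem vecComp_injective {φ : OpenPartialHomeomorph M (Coord m)}
    (hφ : φ ∈ IsManifold.maximalAtlas 𝓘(ℝ, Coord m) ∞ M) {p : M} (hp : p ∈ φ.source) :
    Function.Injective (vecComp φ p) :=
  (mdifferentiable_chart hφ).mfderiv_injective hp

/-- Identifies the quadratic term of the geodesic equation with the chart-free vector `T(X, X)`,
which can be compared between different charts. -/
theorem sum_tensorComp (T : TensorField m M) {φ : OpenPartialHomeomorph M (Coord m)}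
    (hφ : φ ∈ IsManifold.maximalAtlas 𝓘(ℝ, Coord m) ∞ M) {p : M} (hp : p ∈ φ.source)
    (X : TangentSpace 𝓘(ℝ, Coord m) p) (k : Fin (m + 2)) :
    ∑ i, ∑ j, tensorComp T φ (φ p) i j k * vecComp φ p X i * vecComp φ p X j =
      vecComp φ p (T p X X) k := by
  -- Coordinate fields are based at `φ.symm x`; writing `p` in this form puts all vectors in the
  -- same tangent space.
  obtain ⟨x, hx, rfl⟩ : ∃ x ∈ φ.target, φ.symm x = p := ⟨φ p, φ.map_source hp, φ.left_inv hp⟩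
  rw [φ.right_inv hx]
  set a := vecComp φ (φ.symm x) X with ha
  have hX := eq_sum_coordField hφ hx X
  have h1 : T (φ.symm x) X X
      = ∑ i, ∑ j, (a i * a j) • T (φ.symm x) (coordField φ x i) (coordField φ x j) := by
    conv_lhs => rw [hX]
    simp only [map_sum, map_smul, _root_.sum_apply, _root_.smul_apply,
      smul_smul, Finset.smul_sum]
    rw [Finset.sum_comm]
    simp only [mul_comm, ha]
  let P : TangentSpace 𝓘(ℝ, Coord m) (φ.symm x) →L[ℝ] ℝ :=
    (EuclideanSpace.proj k : Coord m →L[ℝ] ℝ).comp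
      (mfderiv 𝓘(ℝ, Coord m) 𝓘(ℝ, Coord m) φ (φ.symm x))
  have h2 : ∀ Y, vecComp φ (φ.symm x) Y k = P Y := fun Y ↦ rfl
  simp only [tensorComp]
  rw [h1]
  simp only [h2, map_sum, map_smul, smul_eq_mul]
  refine Finset.sum_congr rfl fun i _ ↦ Finset.sum_congr rfl fun j _ ↦ ?_
  ring

theorem hasDerivAt_chart_comp {φ : OpenPartialHomeomorph M (Coord m)}
    (hφ : φ ∈ IsManifold.maximalAtlas 𝓘(ℝ, Coord m) ∞ M) {γ : ℝ → M} {I : Set ℝ} (hI : IsOpen I)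
    (hγ : ContMDiffOn 𝓘(ℝ, ℝ) 𝓘(ℝ, Coord m) ∞ γ I) {t : ℝ} (ht : t ∈ I)
    (hp : γ t ∈ φ.source) (k : Fin (m + 2)) :
    ContDiffAt ℝ ∞ (fun τ ↦ φ (γ τ) k) t ∧
      deriv (fun τ ↦ φ (γ τ) k) t = vecComp φ (γ t) (velocity γ t) k := by
  have h1 : ContMDiffAt 𝓘(ℝ, ℝ) 𝓘(ℝ, Coord m) ∞ γ t := hγ.contMDiffAt (hI.mem_nhds ht)
  have h2 : ContMDiffAt 𝓘(ℝ, Coord m) 𝓘(ℝ, Coord m) ∞ φ (γ t) :=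
    (contMDiffOn_of_mem_maximalAtlas hφ).contMDiffAt (φ.open_source.mem_nhds hp)
  have h3 : ContDiffAt ℝ ∞ (φ ∘ γ) t := (h2.comp t h1).contDiffAt
  have h4 : ContDiffAt ℝ ∞ (fun τ ↦ φ (γ τ) k) t := (contDiffAt_euclidean.1 h3) k
  refine ⟨h4, ?_⟩
  have h5 : fderiv ℝ (φ ∘ γ) t 1 = vecComp φ (γ t) (velocity γ t) := by
    rw [← mfderiv_eq_fderiv]
    exact mfderiv_comp_apply t (h2.mdifferentiableAt (by simp)) (h1.mdifferentiableAt (by simp)) _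
  have h6 := ((EuclideanSpace.proj k : Coord m →L[ℝ] ℝ).hasFDerivAt.comp t
    (h3.differentiableAt (by simp)).hasFDerivAt).hasDerivAt.deriv
  rw [← h5]
  exact h6

/-- The coordinate fields are images of constant fields under the tangent map of `φ.symm`, hence
smooth; inserting them into `T` and applying the tangent map of `φ` keeps smoothness. -/
theorem contDiffOn_tensorComp [IsManifold 𝓘(ℝ, Coord m) ∞ M] {T : TensorField m M}
    (hT : ContMDiff 𝓘(ℝ, Coord m)
      (𝓘(ℝ, Coord m).prod 𝓘(ℝ, Coord m →L[ℝ] Coord m →L[ℝ] Coord m)) ∞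
      (fun p ↦ TotalSpace.mk' (Coord m →L[ℝ] Coord m →L[ℝ] Coord m) p (T p)))
    {φ : OpenPartialHomeomorph M (Coord m)}
    (hφ : φ ∈ IsManifold.maximalAtlas 𝓘(ℝ, Coord m) ∞ M) (i j k : Fin (m + 2)) :
    ContDiffOn ℝ ∞ (fun x ↦ tensorComp T φ x i j k) φ.target := by
  have hs := contMDiffOn_symm_of_mem_maximalAtlas hφ
  have hc := contMDiffOn_of_mem_maximalAtlas hφ
  have h1 : ∀ i, ContMDiffOn 𝓘(ℝ, Coord m) 𝓘(ℝ, Coord m).tangent ∞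
      (fun x ↦ (TotalSpace.mk' (Coord m) (φ.symm x) (coordField φ x i) :
        TangentBundle 𝓘(ℝ, Coord m) M)) φ.target := by
    intro i
    have hv : ContMDiff 𝓘(ℝ, Coord m) 𝓘(ℝ, Coord m).tangent ∞
        (fun x : Coord m ↦ (TotalSpace.mk' (Coord m) x (coordVec i) :
          TangentBundle 𝓘(ℝ, Coord m) (Coord m))) :=
      contMDiff_vectorSpace_iff_contDiff.2 contDiff_const
    have := (hs.contMDiffOn_tangentMapWithin (m := ∞) (by simp)
      φ.open_target.uniqueMDiffOn).comp hv.contMDiffOn (s := φ.target) (fun x hx ↦ hx)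
    refine this.congr fun x hx ↦ ?_
    simp only [Function.comp, tangentMapWithin, coordField,
      mfderivWithin_of_isOpen φ.open_target hx]
  have h2 : ContMDiffOn 𝓘(ℝ, Coord m) 𝓘(ℝ, Coord m).tangent ∞
      (fun x ↦ (TotalSpace.mk' (Coord m) (φ.symm x)
        (T (φ.symm x) (coordField φ x i) (coordField φ x j)) :
        TangentBundle 𝓘(ℝ, Coord m) M)) φ.target :=
    ContMDiffOn.clm_bundle_apply₂ (hT.comp_contMDiffOn hs) (h1 i) (h1 j)
  have h3 := (hc.contMDiffOn_tangentMapWithin (m := ∞) (by simp)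
      φ.open_source.uniqueMDiffOn).comp h2 (fun x hx ↦ φ.map_target hx)
  have h4 := (contMDiff_snd_tangentBundle_modelSpace (n := ∞) (Coord m)
    𝓘(ℝ, Coord m)).comp_contMDiffOn h3
  have h5 := contDiffOn_euclidean.1 h4.contDiffOn k
  refine h5.congr fun x hx ↦ ?_
  simp only [Function.comp, tangentMapWithin, tensorComp, vecComp,
      mfderivWithin_of_isOpen φ.open_source (φ.map_target hx)]

end Charts

/-! ### Homogeneous structures in adapted charts -/

section Metric

variable {m : ℕ} {M : Type*} [TopologicalSpace M] [ChartedSpace (Coord m) M]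
  [IsManifold 𝓘(ℝ, Coord m) ∞ M] {g : LorentzianMetric m M} {T : TensorField m M}
  {γ : ℝ → M} {I J : Set ℝ} {φ : OpenPartialHomeomorph M (Coord m)}

theorem metricComp_symm (g : LorentzianMetric m M) (φ : OpenPartialHomeomorph M (Coord m))
    (x : Coord m) (i j : Fin (m + 2)) : metricComp g φ x i j = metricComp g φ x j i :=
  g.symm _ _ _

/-- Lowering the upper index cancels the inverse matrix and leaves the Christoffel symbols of the
first kind. -/
theorem sum_leviCivita_mul_metricComp {x : Coord m}
    (hdet : (Matrix.of (metricComp g φ x)).det ≠ 0) (i j n : Fin (m + 2)) :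
    ∑ a, leviCivita g φ x i j a * metricComp g φ x a n =
      (1 / 2) * (pderiv i (fun y ↦ metricComp g φ y j n) x
        + pderiv j (fun y ↦ metricComp g φ y i n) x
        - pderiv n (fun y ↦ metricComp g φ y i j) x) := by
  set G := Matrix.of (metricComp g φ x) with hG
  have h1 : ∀ l, ∑ a, G n a * G⁻¹ a l = if n = l then 1 else 0 := by
    intro l
    have := congrFun (congrFun (Matrix.mul_nonsing_inv G (isUnit_iff_ne_zero.2 hdet)) n) l
    rwa [Matrix.mul_apply, Matrix.one_apply] at this
  set c : Fin (m + 2) → ℝ := fun l ↦ pderiv i (fun y ↦ metricComp g φ y j l) x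
        + pderiv j (fun y ↦ metricComp g φ y i l) x
        - pderiv l (fun y ↦ metricComp g φ y i j) x with hc
  calc ∑ a, leviCivita g φ x i j a * metricComp g φ x a n
      = ∑ a, ∑ l, (1 / 2) * c l * (G n a * G⁻¹ a l) := by
        refine Finset.sum_congr rfl fun a _ ↦ ?_
        rw [leviCivita, metricComp_symm g φ x a n, Finset.mul_sum, Finset.sum_mul]
        refine Finset.sum_congr rfl fun l _ ↦ ?_
        simp only [hc, hG, Matrix.of_apply]
        ring
    _ = (1 / 2) * c n := by
        rw [Finset.sum_comm]
        simp [← Finset.mul_sum, h1]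

/-- The tensor `T` of a homogeneous structure is skew-symmetric for the metric. -/
theorem IsHomogeneousStructure.sum_tensorComp_mul_metricComp (hT : IsHomogeneousStructure g T)
    (hφ : φ ∈ IsManifold.maximalAtlas 𝓘(ℝ, Coord m) ∞ M) {x : Coord m} (hx : x ∈ φ.target)
    (hdet : (Matrix.of (metricComp g φ x)).det ≠ 0) (l i j : Fin (m + 2)) :
    ∑ a, tensorComp T φ x l i a * metricComp g φ x a j +
      ∑ a, tensorComp T φ x l j a * metricComp g φ x a i = 0 := by
  have h1 := hT.metric φ hφ x hx l i j
  -- The two first-kind symbols add up to `∂_l g_{ij}`, so the Levi-Civita part drops out of the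
  -- metric condition and only `T` remains.
  have h2 := sum_leviCivita_mul_metricComp hdet l i j
  have h3 := sum_leviCivita_mul_metricComp hdet l j i
  simp only [metricComp_symm g φ _ j i] at h3
  simp only [covDerivMetric, canonical, sub_mul, Finset.sum_sub_distrib,
    metricComp_symm g φ x i] at h1
  linarith

/-- Pairing a vector with `∂_u` therefore reads off half its `v`-component; this is how
skew-symmetry yields information on `T^v`. -/
theorem IsAdaptedChart.metricComp_zero_right (hφ : IsAdaptedChart g γ J φ) {x : Coord m}
    (hx : x ∈ φ.target) (a : Fin (m + 2)) :
    metricComp g φ x a 0 = if a = 1 then 1 / 2 else 0 := by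
  rw [metricComp_symm]
  refine Fin.cases ?_ (fun a ↦ Fin.cases ?_ (fun i ↦ ?_) a) a
  · simpa using hφ.metric_uu x hx
  · simpa using hφ.metric_uv x hx
  · have : i.succ.succ ≠ (1 : Fin (m + 2)) := by simp [Fin.ext_iff]
    rw [if_neg this]
    exact hφ.metric_uy x hx i

theorem IsAdaptedChart.eq_zero_of_sum_metricComp (hφ : IsAdaptedChart g γ J φ) {x : Coord m}
    (hx : x ∈ φ.target) {w : Fin (m + 2) → ℝ} (hw : w 1 = 0)
    (h : ∀ j : Fin m, ∑ a, w a * metricComp g φ x a j.succ.succ = 0) (i : Fin m) :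
    w i.succ.succ = 0 := by
  have hC := (hφ.metric_yy x hx).isUnit
  rw [Matrix.isUnit_iff_isUnit_det, isUnit_iff_ne_zero] at hC
  have h1 := Matrix.eq_zero_of_vecMul_eq_zero hC (v := fun i : Fin m ↦ w i.succ.succ) (by
    ext j
    have := h j
    rw [Fin.sum_univ_succ, Fin.sum_univ_succ] at this
    rw [Fin.succ_zero_eq_one, hw, hφ.metric_uy x hx j] at this
    simpa [Matrix.vecMul, dotProduct] using this)
  exact congrFun h1 i

/-- For a vector in the kernel, pairing with `∂_u` kills the `v`-component, then positivity of `C`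
the `y`-components, and pairing with `∂_v` the `u`-component. -/
theorem IsAdaptedChart.det_ne_zero (hφ : IsAdaptedChart g γ J φ) {x : Coord m}
    (hx : x ∈ φ.target) : (Matrix.of (metricComp g φ x)).det ≠ 0 := by
  intro h0
  obtain ⟨w, hw, hw0⟩ := Matrix.exists_vecMul_eq_zero_iff.2 h0
  have h : ∀ j, ∑ a, w a * metricComp g φ x a j = 0 := fun j ↦ congrFun hw0 j
  have h1 : w 1 = 0 := by simpa [hφ.metricComp_zero_right hx] using h 0
  have h2 := hφ.eq_zero_of_sum_metricComp hx h1 fun j ↦ h _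
  apply hw
  have h3 : w 0 = 0 := by
    have := h 1
    rw [Fin.sum_univ_succ, Fin.sum_univ_succ, Fin.succ_zero_eq_one, h1,
      hφ.metric_uv x hx] at this
    simpa [h2] using this
  ext a
  exact Fin.cases h3 (fun a ↦ Fin.cases h1 h2 a) a

/-- In adapted coordinates, `T_{Xu}^v = 0`. -/
theorem IsHomogeneousStructure.tensorComp_u_v (hT : IsHomogeneousStructure g T)
    (hφ : IsAdaptedChart g γ J φ) {x : Coord m} (hx : x ∈ φ.target) (l : Fin (m + 2)) :
    tensorComp T φ x l 0 1 = 0 := by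
  -- Skew-symmetry on the pair `(∂_u, ∂_u)`: both sums equal half of `T_{lu}^v`.
  have := hT.sum_tensorComp_mul_metricComp hφ.mem_atlas hx (hφ.det_ne_zero hx) l 0 0
  simp [hφ.metricComp_zero_right hx] at this
  linarith

/-- Skew-symmetry of `T_{∂_u}` on the pair `(∂_u, ∂_{y^j})`: the first term involves only `T_{uu}^v`
and `T_{uu}^y`, since `g_{uy} = 0`, and the second is half of `T_{uy}^v`. -/
theorem IsHomogeneousStructure.tensorComp_y_v (hT : IsHomogeneousStructure g T)
    (hφ : IsAdaptedChart g γ J φ) {x : Coord m} (hx : x ∈ φ.target)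
    (h : ∀ i : Fin m, tensorComp T φ x 0 0 i.succ.succ = 0) (j : Fin m) :
    tensorComp T φ x 0 j.succ.succ 1 = 0 := by
  have h1 := hT.sum_tensorComp_mul_metricComp hφ.mem_atlas hx (hφ.det_ne_zero hx) 0 0 j.succ.succ
  rw [Fin.sum_univ_succ, Fin.sum_univ_succ, Fin.succ_zero_eq_one, hT.tensorComp_u_v hφ hx,
    hφ.metric_uy x hx j] at h1
  simpa [h, hφ.metricComp_zero_right hx] using h1

theorem IsAdaptedChart.smul_mem_target (hφ : IsAdaptedChart g γ J φ) {t : ℝ} (ht : t ∈ J) :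
    t • coordVec 0 ∈ φ.target :=
  hφ.curve t ht ▸ φ.map_source (hφ.mem_source t ht)

/-! ### Convergence of the rescaled tensors -/

/-- The alternatives are: nonnegative exponent, where continuity suffices; a component zero near the
limit point on `γ`; exponent at least -1 with a zero at that point, where the derivative in `Ω`
controls the quotient. -/
theorem tendsto_pullback_scaling {S : Coord m → Fin (m + 2) → Fin (m + 2) → Fin (m + 2) → ℝ}
    {x : Coord m} {i j k : Fin (m + 2)}
    (hd : DifferentiableAt ℝ (fun y ↦ S y i j k) (x 0 • coordVec 0))
    (h : weight m k ≤ weight m i + weight m j ∨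
      (∀ᶠ y in 𝓝 (x 0 • coordVec 0), S y i j k = 0) ∨
      (weight m k ≤ weight m i + weight m j + 1 ∧ S (x 0 • coordVec 0) i j k = 0)) :
    ∃ L, Tendsto (fun Ω : ℝ ↦ pullback (scaling Ω) S x i j k) (𝓝[>] 0) (𝓝 L) := by
  have hc : Tendsto (fun Ω ↦ scaling Ω x) (𝓝[>] 0) (𝓝 (x 0 • coordVec 0)) := by
    have := (differentiable_scaling x).continuous.tendsto 0
    rw [scaling_zero] at this
    exact this.mono_left nhdsWithin_le_nhds
  have hpos : ∀ᶠ Ω : ℝ in 𝓝[>] 0, 0 < Ω := self_mem_nhdsWithin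
  have hpow : ∀ n : ℕ, Tendsto (fun Ω : ℝ ↦ Ω ^ n) (𝓝[>] 0) (𝓝 (0 ^ n)) := fun n ↦
    ((continuous_pow n).tendsto 0).mono_left nhdsWithin_le_nhds
  rcases h with h | h | ⟨h, h0⟩
  -- Since `0 ^ 0 = 1`, one formula covers exponent zero, where the component survives, and positive
  -- exponents, where the limit is 0.
  · refine ⟨0 ^ (weight m i + weight m j - weight m k) * S (x 0 • coordVec 0) i j k,
      ((hpow _).mul (hd.continuousAt.tendsto.comp hc)).congr' ?_⟩
    filter_upwards [hpos] with Ω hΩ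
    rw [pullback_scaling hΩ, pow_sub₀ _ hΩ.ne' h, pow_add]
    rfl
  · refine ⟨0, tendsto_const_nhds.congr' ?_⟩
    filter_upwards [hpos, hc.eventually h] with Ω hΩ h
    rw [pullback_scaling hΩ, h, mul_zero]
  · have hD : DifferentiableAt ℝ (fun Ω ↦ S (scaling Ω x) i j k) 0 := by
      refine DifferentiableAt.comp (𝕜 := ℝ) (g := fun y ↦ S y i j k) 0 ?_
        (differentiable_scaling x 0)
      rwa [scaling_zero]
    -- One factor `Ω` is borrowed from the slope, so the exponent stays a natural number.
    refine ⟨_, ((hpow (weight m i + weight m j + 1 - weight m k)).mul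
      hD.hasDerivAt.tendsto_slope_zero_right).congr' ?_⟩
    filter_upwards [hpos] with Ω hΩ
    rw [pullback_scaling hΩ, pow_sub₀ _ hΩ.ne' h, pow_succ, pow_add, zero_add, scaling_zero, h0]
    rw [sub_zero, smul_eq_mul]
    field_simp

/-- The point is fixed by `ψ_Ω`, so the entry is `Ω⁻¹` times a constant; multiplying by `Ω` shows
that the constant is 0. -/
theorem eq_zero_of_tendsto_pullback_scaling
    {S : Coord m → Fin (m + 2) → Fin (m + 2) → Fin (m + 2) → ℝ} {t L : ℝ} {k : Fin (m + 2)}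
    (hk : weight m k = 1)
    (h : Tendsto (fun Ω : ℝ ↦ pullback (scaling Ω) S (t • coordVec 0) 0 0 k) (𝓝[>] 0) (𝓝 L)) :
    S (t • coordVec 0) 0 0 k = 0 := by
  have hid : Tendsto (fun Ω : ℝ ↦ Ω) (𝓝[>] 0) (𝓝 0) := nhdsWithin_le_nhds
  have h1 := hid.mul h
  rw [zero_mul] at h1
  refine tendsto_nhds_unique (tendsto_const_nhds.congr' ?_) h1
  filter_upwards [self_mem_nhdsWithin] with Ω hΩ
  have hΩ' : Ω ≠ 0 := (mem_Ioi.1 hΩ).ne'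
  rw [pullback_scaling hΩ, scaling_smul_coordVec_zero, hk]
  simp [hΩ']

theorem hasLimitAt_of_tensorComp_eq_zero (hT : IsHomogeneousStructure g T)
    (hφ : IsAdaptedChart g γ J φ) {x : Coord m} (hx : x 0 ∈ J)
    (h : ∀ i : Fin m, tensorComp T φ (x 0 • coordVec 0) 0 0 i.succ.succ = 0) :
    HasLimitAt T φ x := by
  have hx' := hφ.smul_mem_target hx
  have hev : ∀ l, ∀ᶠ y in 𝓝 (x 0 • coordVec 0), tensorComp T φ y l 0 1 = 0 := fun l ↦
    eventually_of_mem (φ.open_target.mem_nhds hx') fun y hy ↦ hT.tensorComp_u_v hφ hy l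
  have key : ∀ i j k, ∃ L, Tendsto
      (fun Ω : ℝ ↦ pullback (scaling Ω) (tensorComp T φ) x i j k) (𝓝[>] 0) (𝓝 L) := by
    intro i j k
    refine tendsto_pullback_scaling (((contDiffOn_tensorComp hT.smooth hφ.mem_atlas i j
      k).contDiffAt (φ.open_target.mem_nhds hx')).differentiableAt (by simp)) ?_
    -- Upper index `v` with second lower index `u` vanishes on the chart; `T_{uy}^v` and `T_{uu}^y`
    -- have exponent -1 and vanish on `γ`; every other exponent is nonnegative.
    refine Fin.cases (by simp) (fun k ↦ Fin.cases ?_ (fun k ↦ ?_) k) k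
    · rw [Fin.succ_zero_eq_one]
      refine Fin.cases (.inr (.inl (hev i))) (fun j ↦ Fin.cases (by simp) (fun j ↦ ?_) j) j
      refine Fin.cases ?_ (fun i ↦ Fin.cases (by simp) (fun i ↦ by simp) i) i
      exact .inr (.inr ⟨by simp, hT.tensorComp_y_v hφ hx' h j⟩)
    · refine Fin.cases ?_ (fun i ↦ Fin.cases (.inl (by simp; omega)) (fun i ↦ by simp) i) i
      refine Fin.cases ?_ (fun j ↦ Fin.cases (by simp) (fun j ↦ by simp) j) j
      exact .inr (.inr ⟨by simp, h k⟩)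
  choose L hL using key
  exact ⟨L, tendsto_pi_nhds.2 fun i ↦ tendsto_pi_nhds.2 fun j ↦ tendsto_pi_nhds.2 fun k ↦
    hL i j k⟩

/-! ### Reparametrized geodesics -/

/-- The equation of geodesics of the canonical connection for a reparametrized geodesic of the
Levi-Civita connection. -/
theorem canonical_geodesic_comp (T : TensorField m M) (hI : IsOpen I)
    (hγ : IsGeodesicOn (leviCivita g) γ I) {s : ℝ → ℝ} {t : ℝ} (hs : ContDiffAt ℝ ∞ s t)
    (ht : s t ∈ I) (hφ : φ ∈ IsManifold.maximalAtlas 𝓘(ℝ, Coord m) ∞ M)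
    (hp : γ (s t) ∈ φ.source) (k : Fin (m + 2)) :
    deriv (deriv fun τ ↦ φ ((γ ∘ s) τ) k) t +
      ∑ i, ∑ j, canonical g T φ (φ ((γ ∘ s) t)) i j k *
        deriv (fun τ ↦ φ ((γ ∘ s) τ) i) t * deriv (fun τ ↦ φ ((γ ∘ s) τ) j) t =
    deriv (deriv s) t * vecComp φ (γ (s t)) (velocity γ (s t)) k - deriv s t ^ 2 *
      vecComp φ (γ (s t)) (T (γ (s t)) (velocity γ (s t)) (velocity γ (s t))) k := by
  have h1 := fun i ↦ hasDerivAt_chart_comp hφ hI hγ.1 ht hp i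
  have h0 : (2 : WithTop ℕ∞) ≤ ∞ := WithTop.coe_le_coe.2 (le_top : (2 : ℕ∞) ≤ ⊤)
  have h2 := fun i ↦ deriv_deriv_comp (hs.of_le h0)
    ((h1 i).1.of_le h0)
  have h3 := hγ.2 φ hφ (s t) ht hp k
  rw [← sum_tensorComp T hφ hp]
  have h4 : ∀ i, deriv (fun τ ↦ φ ((γ ∘ s) τ) i) t =
      deriv s t * vecComp φ (γ (s t)) (velocity γ (s t)) i := fun i ↦ by
    rw [← (h1 i).2]
    exact (h2 i).1
  have h5 := (h2 k).2
  simp only [(h1 _).2] at h3 h5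
  simp only [h4]
  change deriv (deriv fun τ ↦ φ ((γ ∘ s) τ) k) t = _ at h5
  -- The Levi-Civita equation of `γ` replaces its second derivative; the Christoffel terms, both
  -- scaled by `s'^2`, then cancel.
  rw [h5, eq_neg_of_add_eq_zero_left h3]
  simp only [canonical, Function.comp, mul_neg, Finset.mul_sum, sub_mul, Finset.sum_sub_distrib]
  have h6 : ∀ f : Fin (m + 2) → Fin (m + 2) → ℝ, ∀ a : Fin (m + 2) → ℝ,
      ∑ i, ∑ j, f i j * (deriv s t * a i) * (deriv s t * a j) =
        ∑ i, ∑ j, deriv s t ^ 2 * (f i j * a i * a j) := fun f a ↦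
    Finset.sum_congr rfl fun i _ ↦ Finset.sum_congr rfl fun j _ ↦ by ring
  rw [h6 (fun i j ↦ leviCivita g φ (φ (γ (s t))) i j k),
    h6 (fun i j ↦ tensorComp T φ (φ (γ (s t))) i j k)]
  ring

theorem IsAdaptedChart.vecComp_velocity (hφ : IsAdaptedChart g γ J φ) (hJ : J ⊆ I)
    (hI : IsOpen I) (hγ : ContMDiffOn 𝓘(ℝ, ℝ) 𝓘(ℝ, Coord m) ∞ γ I) {t : ℝ} (ht : t ∈ J) :
    vecComp φ (γ t) (velocity γ t) = coordVec 0 := by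
  ext k
  rw [← (hasDerivAt_chart_comp hφ.mem_atlas hI hγ (hJ ht) (hφ.mem_source t ht) k).2]
  have h1 : (fun τ ↦ φ (γ τ) k) =ᶠ[𝓝 t] fun τ ↦ τ * (coordVec 0 : Coord m) k :=
    eventually_of_mem (hφ.isOpen.mem_nhds ht) fun τ hτ ↦ by simp [hφ.curve τ hτ]
  rw [h1.deriv_eq]
  simp

theorem IsAdaptedChart.vecComp_tensor_velocity (T : TensorField m M)
    (hφ : IsAdaptedChart g γ J φ) (hJ : J ⊆ I)
    (hI : IsOpen I) (hγ : ContMDiffOn 𝓘(ℝ, ℝ) 𝓘(ℝ, Coord m) ∞ γ I) {t : ℝ} (ht : t ∈ J)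
    (k : Fin (m + 2)) :
    vecComp φ (γ t) (T (γ t) (velocity γ t) (velocity γ t)) k =
      tensorComp T φ (φ (γ t)) 0 0 k := by
  rw [← sum_tensorComp T hφ.mem_atlas (hφ.mem_source t ht), hφ.vecComp_velocity hJ hI hγ ht]
  simp [coordVec_apply]

/-- If `T_{uu}^y = 0` along `γ`, then `T(γ', γ')` is a smooth multiple of `γ'`. -/
theorem exists_tensor_velocity_eq_smul (hT : IsHomogeneousStructure g T)
    (hγ : IsNullGeodesic g γ I)
    {𝒰 : Set (OpenPartialHomeomorph M (Coord m) × Set ℝ)} (h𝒰 : IsAdaptedCover g γ I 𝒰)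
    (h : ∀ U ∈ 𝒰, ∀ t ∈ U.2, ∀ i : Fin m, tensorComp T U.1 (U.1 (γ t)) 0 0 i.succ.succ = 0) :
    ∃ f : ℝ → ℝ, ContDiffOn ℝ ∞ f I ∧
      ∀ t ∈ I, T (γ t) (velocity γ t) (velocity γ t) = f t • velocity γ t := by
  have key : ∀ U ∈ 𝒰, ∀ t ∈ U.2, T (γ t) (velocity γ t) (velocity γ t) =
      tensorComp T U.1 (U.1 (γ t)) 0 0 0 • velocity γ t := by
    intro U hU t ht
    have hφ := h𝒰.adapted U hU
    have hp := hφ.mem_source t ht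
    apply vecComp_injective hφ.mem_atlas hp
    have h1 : vecComp U.1 (γ t) (tensorComp T U.1 (U.1 (γ t)) 0 0 0 • velocity γ t) =
        tensorComp T U.1 (U.1 (γ t)) 0 0 0 • vecComp U.1 (γ t) (velocity γ t) :=
      map_smul (mfderiv 𝓘(ℝ, Coord m) 𝓘(ℝ, Coord m) U.1 (γ t)) _ _
    ext k
    rw [h1, hφ.vecComp_tensor_velocity T (h𝒰.subset U hU) hγ.isOpen hγ.geodesic.1 ht,
      hφ.vecComp_velocity (h𝒰.subset U hU) hγ.isOpen hγ.geodesic.1 ht]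
    refine Fin.cases ?_ (fun k ↦ Fin.cases ?_ (fun k ↦ ?_) k) k
    · simp [coordVec_apply]
    · simpa [coordVec_apply] using hT.tensorComp_u_v hφ (U.1.map_source hp) 0
    · simpa [coordVec_apply] using h U hU t ht k
  have hex : ∀ t, ∃ a : ℝ, t ∈ I →
      T (γ t) (velocity γ t) (velocity γ t) = a • velocity γ t := by
    intro t
    by_cases ht : t ∈ I
    · obtain ⟨U, hU, htU⟩ := h𝒰.cover t ht
      exact ⟨_, fun _ ↦ key U hU t htU⟩
    · exact ⟨0, fun h ↦ absurd h ht⟩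
  choose f hf using hex
  refine ⟨f, fun t ht ↦ ?_, hf⟩
  obtain ⟨U, hU, htU⟩ := h𝒰.cover t ht
  have hφ := h𝒰.adapted U hU
  -- As `γ' ≠ 0`, the factor is unique, so the pointwise choice `f` agrees near `t` with the smooth
  -- `T_{uu}^u` of a single chart.
  have h1 : f =ᶠ[𝓝 t] fun τ ↦ tensorComp T U.1 (τ • coordVec 0) 0 0 0 := by
    refine eventually_of_mem (hφ.isOpen.mem_nhds htU) fun τ hτ ↦ ?_
    have hτI := h𝒰.subset U hU hτ
    refine smul_left_injective ℝ (hγ.velocity_ne_zero τ hτI) ?_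
    change f τ • velocity γ τ = _ • velocity γ τ
    rw [← hf τ hτI, key U hU τ hτ, hφ.curve τ hτ]
  have h2 : ContDiffAt ℝ ∞ (fun τ : ℝ ↦ tensorComp T U.1 (τ • coordVec 0) 0 0 0) t :=
    ContDiffAt.comp (g := fun x ↦ tensorComp T U.1 x 0 0 0) t
      ((contDiffOn_tensorComp hT.smooth hφ.mem_atlas 0 0 0).contDiffAt
        (U.1.open_target.mem_nhds (hφ.smul_mem_target htU)))
      (contDiffAt_id.smul contDiffAt_const)
  exact (h2.congr_of_eventuallyEq h1).contDiffWithinAt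

theorem reparametrizes_of_tensor_velocity_eq_smul (hγ : IsNullGeodesic g γ I) {f : ℝ → ℝ}
    (hf : ContDiffOn ℝ ∞ f I)
    (h : ∀ t ∈ I, T (γ t) (velocity γ t) (velocity γ t) = f t • velocity γ t) :
    ReparametrizesToCanonicalGeodesic g T γ I := by
  obtain ⟨J, s, hJ, hJ', hs, hbij, hs', hs''⟩ := exists_reparametrization hγ.isOpen hγ.interval hf
  refine ⟨J, s, hJ, hJ', hs, hbij, hs', hγ.geodesic.1.comp hs.contMDiffOn hbij.mapsTo, ?_⟩
  intro φ hφ t ht hp k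
  have hst := hbij.mapsTo ht
  rw [canonical_geodesic_comp T hγ.isOpen hγ.geodesic (hs.contDiffAt (hJ.mem_nhds ht)) hst hφ hp,
    h _ hst, hs'' t ht]
  have h1 : vecComp φ (γ (s t)) (f (s t) • velocity γ (s t)) =
      f (s t) • vecComp φ (γ (s t)) (velocity γ (s t)) :=
    map_smul (mfderiv 𝓘(ℝ, Coord m) 𝓘(ℝ, Coord m) φ (γ (s t))) _ _
  rw [h1, PiLp.smul_apply, smul_eq_mul]
  ring

/-- In an adapted chart `γ'` has no `y`-component, so the `y^i`-equation reads `s'^2 T_{uu}^{y^i} =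
0`, and `s' ≠ 0`. -/
theorem ReparametrizesToCanonicalGeodesic.tensorComp_eq_zero (hγ : IsNullGeodesic g γ I)
    (h : ReparametrizesToCanonicalGeodesic g T γ I) (hφ : IsAdaptedChart g γ J φ) (hJI : J ⊆ I)
    {t : ℝ} (ht : t ∈ J) (i : Fin m) : tensorComp T φ (φ (γ t)) 0 0 i.succ.succ = 0 := by
  obtain ⟨J', s, hJ, -, hs, hbij, hs', hgeo⟩ := h
  obtain ⟨τ, hτ, rfl⟩ := hbij.surjOn (hJI ht)
  have hp := hφ.mem_source _ ht
  have h1 := hgeo.2 φ hφ.mem_atlas τ hτ hp i.succ.succ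
  rw [canonical_geodesic_comp T hγ.isOpen hγ.geodesic (hs.contDiffAt (hJ.mem_nhds hτ)) (hJI ht)
    hφ.mem_atlas hp, hφ.vecComp_tensor_velocity T hJI hγ.isOpen hγ.geodesic.1 ht,
    hφ.vecComp_velocity hJI hγ.isOpen hγ.geodesic.1 ht] at h1
  simpa [coordVec_apply, hs' τ hτ] using h1

end Metric

end PenroseLimit

/-! ### The equivalence of the four conditions -/

theorem mainTheorem6 (m : ℕ) {M : Type*} [TopologicalSpace M] [ChartedSpace (Coord m) M]
    [IsManifold 𝓘(ℝ, Coord m) ∞ M] (g : LorentzianMetric m M)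
    (T : TensorField m M) (hT : IsHomogeneousStructure g T)
    (γ : ℝ → M) (I : Set ℝ) (hγ : IsNullGeodesic g γ I)
    (𝒰 : Set (OpenPartialHomeomorph M (Coord m) × Set ℝ)) (h𝒰 : IsAdaptedCover g γ I 𝒰) :
    (HasPenroseLimitAlong T γ 𝒰 ↔ ReparametrizesToCanonicalGeodesic g T γ I) ∧
    (HasPenroseLimitNear T 𝒰 ↔ ReparametrizesToCanonicalGeodesic g T γ I) ∧
    (HasPenroseLimitAlong T γ 𝒰 ↔ ComponentsVanish T γ 𝒰) := by
  have h14 : HasPenroseLimitAlong T γ 𝒰 → ComponentsVanish T γ 𝒰 := by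
    intro h U hU t ht
    have hφ := h𝒰.adapted U hU
    refine ⟨fun i ↦ ?_, hT.tensorComp_u_v hφ (U.1.map_source (hφ.mem_source t ht)) 0⟩
    obtain ⟨L, hL⟩ := h U hU t ht
    rw [hφ.curve t ht] at hL ⊢
    simp only [tendsto_pi_nhds] at hL
    exact eq_zero_of_tendsto_pullback_scaling (weight_succ_succ i) (hL 0 0 i.succ.succ)
  have h42 : ComponentsVanish T γ 𝒰 → HasPenroseLimitNear T 𝒰 := by
    intro h U hU x _ hx0
    have hφ := h𝒰.adapted U hU
    refine hasLimitAt_of_tensorComp_eq_zero hT hφ hx0 fun i ↦ ?_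
    rw [← hφ.curve _ hx0]
    exact (h U hU _ hx0).1 i
  have h21 : HasPenroseLimitNear T 𝒰 → HasPenroseLimitAlong T γ 𝒰 := by
    intro h U hU t ht
    have hφ := h𝒰.adapted U hU
    refine h U hU _ (U.1.map_source (hφ.mem_source t ht)) ?_
    rw [hφ.curve t ht]
    simpa [coordVec_apply] using ht
  have h43 : ComponentsVanish T γ 𝒰 → ReparametrizesToCanonicalGeodesic g T γ I := by
    intro h
    obtain ⟨f, hf, hfT⟩ := exists_tensor_velocity_eq_smul hT hγ h𝒰 fun U hU t ht ↦ (h U hU t ht).1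
    exact reparametrizes_of_tensor_velocity_eq_smul hγ hf hfT
  have h34 : ReparametrizesToCanonicalGeodesic g T γ I → ComponentsVanish T γ 𝒰 := by
    intro h U hU t ht
    have hφ := h𝒰.adapted U hU
    exact ⟨h.tensorComp_eq_zero hγ hφ (h𝒰.subset U hU) ht,
      hT.tensorComp_u_v hφ (U.1.map_source (hφ.mem_source t ht)) 0⟩
  exact ⟨⟨h43 ∘ h14, h21 ∘ h42 ∘ h34⟩, ⟨h43 ∘ h14 ∘ h21, h42 ∘ h34⟩, ⟨h14, h21 ∘ h42⟩⟩
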